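/- Let $p>1$ be a real number. (1) Let $T$ be a measure-preserving transformation of a measure space $(X,\mu)$, let $f\in L^p(\mu)$ be real-valued, and let $(a_n)_{n\ge1}$ be an arbitrary sequence of non-negative integers (or, if $T$ is invertible with measurable inverse, an arbitrary sequence of integers). Then $$\lim_{N\to\infty}\frac{1}{N(\log N)^{1/p}}\sum_{n=1}^N f(T^{a_n}x)=0\quad\text{for a.e. }x .$$ (2) Let $(X,\mu)$ be a probability space whose $\sigma$-algebra contains a countable family of sets separating the points of $X$ (for example a standard Borel or a Lebesgue probability space), and let $T$ be a (not necessarily invertible) measure-preserving transformation of $(X,\mu)$ that is aperiodic, that is, the set of $x$ with $T^n x=x$ for some $n\ge1$ has measure $0$. Let $(M_N)$ be a sequence of real numbers, positive for all sufficiently large $N$, such that $M_N/(N(\log N)^{1/p})\to0$ as $N\to\infty$. Then there exist a real-valued $f\in L^p(\mu)$ and a sequence $(a_n)_{n\ge1}$ of non-negative integers such that $$\limsup_{N\to\infty}\frac{1}{M_N}\sum_{n=1}^N f(T^{a_n}x)=\infty\quad\text{for a.e. }x .$$ Further, the sequence $(a_n)$ may be taken to be the sequence $(2^n)$: there exists a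 real-valued $f\in L^p(\mu)$ for which this holds with $a_n=2^n$. -/

import Mathlib

open MeasureTheory Filter Topology

/-- A self-map `T` of a measure space is aperiodic if almost no point is periodic, i.e. the set of
all `x` such that `T^n x = x` for some `n ≥ 1` is a null set. -/
def IsAperiodic {X : Type*} [MeasurableSpace X] (T : X → X) (μ : Measure X) : Prop :=
  μ (Function.periodicPts T) = 0

/-- The ergodic sum `∑_{n=1}^N f(T^{a_n} x)` along a sequence `a` of nonnegative times. -/
def ergodicSum {X : Type*} (T : X → X) (a : ℕ → ℕ) (f : X → ℝ) (N : ℕ) (x : X) : ℝ :=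
  ∑ n ∈ Finset.Icc 1 N, f (T^[a n] x)

/-- The ergodic sum `∑_{n=1}^N f(T^{a_n} x)` along a sequence `a` of integer times, for an
invertible `T` (the power is taken in the group of permutations of `X`). -/
def ergodicSumInt {X : Type*} (T : Equiv.Perm X) (a : ℕ → ℤ) (f : X → ℝ) (N : ℕ) (x : X) : ℝ :=
  ∑ n ∈ Finset.Icc 1 N, f ((T ^ (a n)) x)

/-! Part (1) uses only that each map `T^[a n]` preserves the measure. On the dyadic block `N ≤ 2 ^
k`, truncate `f` at `ε * k ^ (1 / p)`. The bounded part contributes at most `ε * 2 ^ k * k ^ (1 /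
p)`. The normalised averages of the excess have integrals whose sum over `k` is at most a constant
times the integral of `|f| ^ p` (`sum_largePart_le`), so almost everywhere they tend to `0`.

Part (2) rests on a set of measure at most `1 / L`, `L = 3 ^ d`, in which almost every orbit outside
a small exceptional set spends a whole block of times `4 ^ m`, `R ≈ L * 2 ^ j` consecutive values of
`m` for some `j < L` (`exists_set_containing_block`). Points are coloured by `(ZMod 3) ^ d` through
the base-4 digits of their height in a Rokhlin tower. As `4 ^ r ≡ 1` mod 3, every time `4 ^ m` of
the `j`-th block shifts the colour by the same vector `v j`. The `v j` exhaust the group, so one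
shift carries the point to a prescribed colour, and some colour class has measure at most `1 / L`.
Weighting the set by about `L ^ (1 / p)` costs a bounded `p`-norm and makes the sum up to `N = 6 *
R` about `N * L ^ (1 / p)`. This has order at least `N * (log N) ^ (1 / p)`, because `j < L` forces
`log N ≤ 3 * L`. A series of such examples gives `f`. -/

/-! ### Part (1): truncation along dyadic blocks. -/

theorem sum_Icc_rpow_neg_le {s : ℝ} (hs0 : 0 < s) (hs1 : s < 1) (n : ℕ) :
    ∑ k ∈ Finset.Icc 1 n, (k : ℝ) ^ (-s) ≤ (n : ℝ) ^ (1 - s) / (1 - s) := by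
  have h1 : 0 < 1 - s := by linarith
  induction n with
  | zero => simp [Real.zero_rpow h1.ne']
  | succ n ih =>
    rw [Finset.sum_Icc_succ_top (by omega)]
    have hpos : (0 : ℝ) < n + 1 := by positivity
    have key : (n : ℝ) ^ (1 - s) ≤ ((n : ℝ) + 1) ^ (1 - s) - (1 - s) * ((n : ℝ) + 1) ^ (-s) := by
      -- Bernoulli's inequality for the concave power `1 - s` replaces comparison with an integral.
      have hb := rpow_one_add_le_one_add_mul_self (s := -1 / ((n : ℝ) + 1)) (p := 1 - s)
        (by rw [le_div_iff₀ hpos]; linarith [(Nat.cast_nonneg n : (0 : ℝ) ≤ n)]) h1.le (by linarith)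
      have he : (n : ℝ) = (n + 1) * (1 + -1 / ((n : ℝ) + 1)) := by field_simp; ring
      have hnn : 0 ≤ 1 + -1 / ((n : ℝ) + 1) := by
        have : 1 + -1 / ((n : ℝ) + 1) = n / (n + 1) := by field_simp; ring
        rw [this]; positivity
      have hsplit : ((n : ℝ) + 1) ^ (1 - s) = (n + 1) * ((n : ℝ) + 1) ^ (-s) := by
        rw [sub_eq_add_neg, Real.rpow_add hpos, Real.rpow_one]
      calc (n : ℝ) ^ (1 - s) = ((n : ℝ) + 1) ^ (1 - s) * (1 + -1 / ((n : ℝ) + 1)) ^ (1 - s) := by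
            conv_lhs => rw [he]
            rw [Real.mul_rpow hpos.le hnn]
        _ ≤ ((n : ℝ) + 1) ^ (1 - s) * (1 + (1 - s) * (-1 / ((n : ℝ) + 1))) := by gcongr
        _ = _ := by rw [hsplit]; field_simp; ring
    have : (n : ℝ) ^ (1 - s) / (1 - s) + ((n : ℝ) + 1) ^ (-s) ≤ ((n : ℝ) + 1) ^ (1 - s) / (1 - s) := by
      rw [div_add' _ _ _ h1.ne']
      gcongr
      linarith
    push_cast
    linarith

/-- The part of `|t|` that exceeds the level `c`. -/
noncomputable def largePart (c t : ℝ) : ℝ := if c < |t| then |t| else 0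

theorem largePart_nonneg (c t : ℝ) : 0 ≤ largePart c t := by
  unfold largePart; split_ifs <;> positivity

theorem abs_le_add_largePart {c : ℝ} (hc : 0 ≤ c) (t : ℝ) : |t| ≤ c + largePart c t := by
  unfold largePart; split_ifs <;> linarith

theorem measurable_largePart (c : ℝ) : Measurable (largePart c) :=
  Measurable.ite (measurableSet_lt measurable_const measurable_id.abs) measurable_id.abs
    measurable_const

/-- Only `k < (|t| / ε) ^ p` contribute, and over that range the sum of `k ^ (-1 / p)` is of order
`(|t| / ε) ^ (p - 1)`. -/
theorem sum_largePart_le {p ε : ℝ} (hp : 1 < p) (hε : 0 < ε) (t : ℝ) (K : ℕ) :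
    ∑ k ∈ Finset.Icc 1 K, (k : ℝ) ^ (-(1 / p)) * largePart (ε * (k : ℝ) ^ (1 / p)) t
      ≤ ε ^ (1 - p) / (1 - 1 / p) * |t| ^ p := by
  have hp0 : 0 < p := by linarith
  have hs0 : 0 < 1 / p := by positivity
  have hs1 : 1 / p < 1 := by rw [div_lt_one hp0]; exact hp
  have h1 : 0 < 1 - 1 / p := by linarith
  rcases eq_or_ne t 0 with rfl | ht
  · rw [Finset.sum_eq_zero, abs_zero, Real.zero_rpow hp0.ne', mul_zero]
    intro k _
    simp [largePart]
  have ht : 0 < |t| := abs_pos.2 ht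
  set n := ⌊(|t| / ε) ^ p⌋₊ with hn
  have hle : ∀ k ∈ Finset.Icc 1 K, (k : ℝ) ^ (-(1 / p)) * largePart (ε * (k : ℝ) ^ (1 / p)) t
      ≤ if k ∈ Finset.Icc 1 n then (k : ℝ) ^ (-(1 / p)) * |t| else 0 := by
    intro k hk
    unfold largePart
    split_ifs with ha hb hb
    · exact le_rfl
    · exfalso
      apply hb
      refine Finset.mem_Icc.2 ⟨(Finset.mem_Icc.1 hk).1, Nat.le_floor ?_⟩
      have : (k : ℝ) ^ (1 / p) < |t| / ε := by rw [lt_div_iff₀ hε]; linarith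
      calc (k : ℝ) = ((k : ℝ) ^ (1 / p)) ^ p := by
            rw [← Real.rpow_mul (by positivity), one_div_mul_cancel hp0.ne', Real.rpow_one]
        _ ≤ _ := Real.rpow_le_rpow (by positivity) this.le hp0.le
    · rw [mul_zero]; positivity
    · simp
  calc _ ≤ ∑ k ∈ Finset.Icc 1 K, if k ∈ Finset.Icc 1 n then (k : ℝ) ^ (-(1 / p)) * |t| else 0 :=
        Finset.sum_le_sum hle
    _ = ∑ k ∈ Finset.Icc 1 K with k ∈ Finset.Icc 1 n, (k : ℝ) ^ (-(1 / p)) * |t| := by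
        rw [Finset.sum_filter]
    _ ≤ ∑ k ∈ Finset.Icc 1 n, (k : ℝ) ^ (-(1 / p)) * |t| := by
        apply Finset.sum_le_sum_of_subset_of_nonneg
        · intro k hk; exact (Finset.mem_filter.1 hk).2
        · intros; positivity
    _ ≤ ((n : ℝ) ^ (1 - 1 / p) / (1 - 1 / p)) * |t| := by
        rw [← Finset.sum_mul]; gcongr; exact sum_Icc_rpow_neg_le hs0 hs1 n
    _ ≤ (((|t| / ε) ^ p) ^ (1 - 1 / p) / (1 - 1 / p)) * |t| := by
        gcongr; exact Nat.floor_le (by positivity)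
    _ = _ := by
        rw [← Real.rpow_mul (by positivity), show p * (1 - 1 / p) = p - 1 by field_simp,
          Real.div_rpow ht.le hε.le, show 1 - p = -(p - 1) by ring, Real.rpow_neg hε.le,
          Real.rpow_sub_one ht.ne']
        field_simp

section

variable {X : Type*} [MeasurableSpace X] {μ : Measure X} {p : ℝ}

/-- By invariance the integral of the `k`-th average does not depend on the maps `S n`. The
integrals are summable, so the series of averages is finite almost everywhere and its terms tend to
`0`. -/
theorem ae_tendsto_average_largePart (hp : 1 < p) {S : ℕ → X → X}
    (hS : ∀ n, MeasurePreserving (S n) μ μ) {f : X → ℝ} (hfm : Measurable f)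
    (hf : MemLp f (ENNReal.ofReal p) μ) {ε : ℝ} (hε : 0 < ε) :
    ∀ᵐ x ∂μ, Tendsto (fun k : ℕ => (k : ℝ) ^ (-(1 / p)) * ((2 ^ k : ℝ)⁻¹ *
      ∑ n ∈ Finset.Icc 1 (2 ^ k), largePart (ε * (k : ℝ) ^ (1 / p)) (f (S n x)))) atTop (𝓝 0) := by
  have hp0 : 0 < p := by linarith
  set h : ℕ → X → ℝ := fun k y => (k : ℝ) ^ (-(1 / p)) * largePart (ε * (k : ℝ) ^ (1 / p)) (f y)
  have hnn : ∀ k y, 0 ≤ h k y := fun k y => mul_nonneg (by positivity) (largePart_nonneg _ _)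
  have hm : ∀ k, Measurable (h k) := fun k =>
    ((measurable_largePart _).comp hfm).const_mul _
  set U : ℕ → X → ENNReal := fun k x =>
    ∑ n ∈ Finset.Icc 1 (2 ^ k), ENNReal.ofReal ((2 ^ k : ℝ)⁻¹) * ENNReal.ofReal (h k (S n x))
  have hUm : ∀ k, Measurable (U k) := fun k => Finset.measurable_sum _ fun n _ =>
    (((hm k).comp (hS n).measurable).ennreal_ofReal).const_mul _
  have hU : ∀ k, ∫⁻ x, U k x ∂μ = ∫⁻ x, ENNReal.ofReal (h k x) ∂μ := by
    intro k
    have hmn : ∀ n ∈ Finset.Icc 1 (2 ^ k), Measurable fun x =>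
        ENNReal.ofReal ((2 ^ k : ℝ)⁻¹) * ENNReal.ofReal (h k (S n x)) := fun n _ =>
      (((hm k).comp (hS n).measurable).ennreal_ofReal).const_mul _
    simp only [U]
    rw [lintegral_finsetSum _ hmn]
    have : ∀ n ∈ Finset.Icc 1 (2 ^ k), ∫⁻ x, ENNReal.ofReal ((2 ^ k : ℝ)⁻¹) *
        ENNReal.ofReal (h k (S n x)) ∂μ
        = ENNReal.ofReal ((2 ^ k : ℝ)⁻¹) * ∫⁻ x, ENNReal.ofReal (h k x) ∂μ := by
      intro n _
      rw [lintegral_const_mul' _ _ ENNReal.ofReal_ne_top,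
        (hS n).lintegral_comp (hm k).ennreal_ofReal]
    rw [Finset.sum_congr rfl this, Finset.sum_const, Nat.card_Icc, add_tsub_cancel_right,
      nsmul_eq_mul, ← mul_assoc, ← ENNReal.ofReal_natCast, ← ENNReal.ofReal_mul (by positivity)]
    push_cast
    rw [mul_inv_cancel₀ (by positivity), ENNReal.ofReal_one, one_mul]
  have hint : Integrable (fun x => |f x| ^ p) μ := by
    have := hf.integrable_norm_rpow (by simpa using hp0) ENNReal.ofReal_ne_top
    rwa [ENNReal.toReal_ofReal hp0.le] at this
  have hfin : ∑' k, ∫⁻ x, U k x ∂μ ≠ ⊤ := by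
    simp_rw [hU]
    rw [← lintegral_tsum fun k => (hm k).ennreal_ofReal.aemeasurable]
    have hb : ∀ x, ∑' k, ENNReal.ofReal (h k x)
        ≤ ENNReal.ofReal (ε ^ (1 - p) / (1 - 1 / p) * |f x| ^ p) := by
      intro x
      refine ENNReal.tsum_le_of_sum_range_le fun K => ?_
      rw [← ENNReal.ofReal_sum_of_nonneg fun k _ => hnn k x]
      apply ENNReal.ofReal_le_ofReal
      refine le_trans ?_ (sum_largePart_le hp hε (f x) K)
      -- `0` to a nonzero power is `0`, so the index `k = 0` is harmless.
      have h0 : h 0 x = 0 := by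
        have : -(1 / p) ≠ 0 := by simpa using hp0.ne'
        simp only [h, Nat.cast_zero, Real.zero_rpow this, zero_mul]
      have hsub : ∑ k ∈ Finset.range K, h k x ≤ ∑ k ∈ Finset.range (K + 1), h k x :=
        Finset.sum_le_sum_of_subset_of_nonneg (Finset.range_subset_range.2 (by omega))
          fun k _ _ => hnn k x
      refine hsub.trans (le_of_eq ?_)
      rw [Finset.range_eq_Ico, Finset.sum_eq_sum_Ico_succ_bot (by omega), h0, zero_add]
      rfl
    refine ((lintegral_mono hb).trans_lt ?_).ne
    exact (hint.const_mul _).lintegral_lt_top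
  rw [← lintegral_tsum fun k => (hUm k).aemeasurable] at hfin
  filter_upwards [ae_lt_top (Measurable.tsum hUm) hfin] with x hx
  have ht := ENNReal.tendsto_atTop_zero_of_tsum_ne_top hx.ne
  have ht' := (ENNReal.tendsto_toReal ENNReal.zero_ne_top).comp ht
  refine ht'.congr fun k => ?_
  simp only [Function.comp, U]
  rw [ENNReal.toReal_sum fun n _ => ENNReal.mul_ne_top ENNReal.ofReal_ne_top ENNReal.ofReal_ne_top,
    Finset.mul_sum, Finset.mul_sum]
  refine Finset.sum_congr rfl fun n _ => ?_
  rw [ENNReal.toReal_mul, ENNReal.toReal_ofReal (by positivity), ENNReal.toReal_ofReal (hnn _ _)]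
  simp only [h]
  ring

theorem tendsto_of_dyadic_bound (hp : 1 < p) {u : ℕ → ℝ}
    (hu : ∀ ε > 0, ∀ᶠ k : ℕ in atTop,
      ∑ n ∈ Finset.Icc 1 (2 ^ k), |u n| ≤ ε * (2 ^ k * (k : ℝ) ^ (1 / p))) :
    Tendsto (fun N : ℕ => 1 / ((N : ℝ) * (Real.log N) ^ (1 / p)) * ∑ n ∈ Finset.Icc 1 N, u n)
      atTop (𝓝 0) := by
  have hp0 : 0 < p := by linarith
  rw [Metric.tendsto_atTop]
  intro ε hε
  -- `12 = 2 * 2 * 3`: a factor 2 from rounding `N` up to a power of two, 3 from comparing `k + 1`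
  -- with `log N`, and 2 for strictness.
  obtain ⟨k₀, hk₀⟩ := eventually_atTop.1 (hu (ε / 12) (by positivity))
  refine ⟨2 ^ (k₀ + 1), fun N hN => ?_⟩
  set k := Nat.log 2 N with hk
  have hN0 : N ≠ 0 := by have := Nat.one_le_two_pow (n := k₀ + 1); omega
  have hkk : k₀ + 1 ≤ k := Nat.le_log_of_pow_le (by norm_num) hN
  have hl : 2 ^ k ≤ N := Nat.pow_log_le_self 2 hN0
  have hr : N < 2 ^ (k + 1) := Nat.lt_pow_succ_log_self (by norm_num) N
  have hlR : (2 : ℝ) ^ k ≤ N := by exact_mod_cast hl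
  have hNpos : (0 : ℝ) < N := by positivity
  have hlog : ((k + 1 : ℕ) : ℝ) ≤ 3 * Real.log N := by
    have h1 : (k : ℝ) * Real.log 2 ≤ Real.log N := by
      rw [← Real.log_pow]; exact Real.log_le_log (by positivity) hlR
    have h2 := Real.log_two_gt_d9
    have h3 : (1 : ℝ) ≤ k := by exact_mod_cast (by omega : 1 ≤ k)
    push_cast
    nlinarith
  have hlogpos : 0 < Real.log N := by
    have : (0 : ℝ) < ((k + 1 : ℕ) : ℝ) := by positivity
    linarith
  have hrp : ((k + 1 : ℕ) : ℝ) ^ (1 / p) ≤ 3 * Real.log N ^ (1 / p) := by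
    calc ((k + 1 : ℕ) : ℝ) ^ (1 / p) ≤ (3 * Real.log N) ^ (1 / p) := by gcongr
      _ = 3 ^ (1 / p) * Real.log N ^ (1 / p) := Real.mul_rpow (by norm_num) hlogpos.le
      _ ≤ 3 ^ (1 : ℝ) * Real.log N ^ (1 / p) := by
          gcongr
          · norm_num
          · rw [div_le_one hp0]; exact hp.le
      _ = _ := by rw [Real.rpow_one]
  have hden : 0 < (N : ℝ) * Real.log N ^ (1 / p) := by positivity
  rw [dist_zero_right, Real.norm_eq_abs, abs_mul, abs_of_pos (by positivity : (0:ℝ) <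
    1 / ((N : ℝ) * (Real.log N) ^ (1 / p))), one_div_mul_eq_div, div_lt_iff₀ hden]
  calc |∑ n ∈ Finset.Icc 1 N, u n| ≤ ∑ n ∈ Finset.Icc 1 N, |u n| := Finset.abs_sum_le_sum_abs _ _
    _ ≤ ∑ n ∈ Finset.Icc 1 (2 ^ (k + 1)), |u n| :=
        Finset.sum_le_sum_of_subset_of_nonneg (Finset.Icc_subset_Icc le_rfl hr.le)
          fun _ _ _ => abs_nonneg _
    _ ≤ ε / 12 * (2 ^ (k + 1) * ((k + 1 : ℕ) : ℝ) ^ (1 / p)) := hk₀ _ (by omega)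
    _ ≤ ε / 12 * ((2 * N) * (3 * Real.log N ^ (1 / p))) := by
        gcongr
        rw [pow_succ]; linarith
    _ = ε / 2 * (N * Real.log N ^ (1 / p)) := by ring
    _ < ε * (N * Real.log N ^ (1 / p)) := by gcongr; linarith

theorem ae_tendsto_average_of_measurePreserving (hp : 1 < p) {S : ℕ → X → X}
    (hS : ∀ n, MeasurePreserving (S n) μ μ) {f : X → ℝ} (hf : MemLp f (ENNReal.ofReal p) μ) :
    ∀ᵐ x ∂μ, Tendsto (fun N : ℕ => 1 / ((N : ℝ) * (Real.log N) ^ (1 / p)) *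
      ∑ n ∈ Finset.Icc 1 N, f (S n x)) atTop (𝓝 0) := by
  wlog hfm : Measurable f generalizing f
  · set g := hf.1.mk f
    have hfg : f =ᵐ[μ] g := hf.1.ae_eq_mk
    have hg := this (MemLp.ae_eq hfg hf) hf.1.measurable_mk
    have hall : ∀ᵐ x ∂μ, ∀ n, f (S n x) = g (S n x) :=
      ae_all_iff.2 fun n => (hS n).quasiMeasurePreserving.ae hfg
    filter_upwards [hg, hall] with x hx hx'
    simpa only [hx'] using hx
  have key : ∀ r : ℕ, ∀ᵐ x ∂μ, Tendsto (fun k : ℕ => (k : ℝ) ^ (-(1 / p)) * ((2 ^ k : ℝ)⁻¹ *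
      ∑ n ∈ Finset.Icc 1 (2 ^ k), largePart (1 / ((r : ℝ) + 1) * (k : ℝ) ^ (1 / p)) (f (S n x))))
      atTop (𝓝 0) := fun r =>
    ae_tendsto_average_largePart hp hS hfm hf Nat.one_div_pos_of_nat
  filter_upwards [ae_all_iff.2 key] with x hx
  refine tendsto_of_dyadic_bound hp fun ε hε => ?_
  obtain ⟨r, hr⟩ := exists_nat_one_div_lt (half_pos hε)
  filter_upwards [(hx r).eventually_lt_const (half_pos hε), eventually_ge_atTop 1] with k hk hk1
  have hkpos : (0 : ℝ) < k := by exact_mod_cast hk1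
  have hkr : 0 < (k : ℝ) ^ (1 / p) := by positivity
  rw [Real.rpow_neg hkpos.le, ← mul_assoc, ← mul_inv, inv_mul_lt_iff₀ (by positivity)] at hk
  calc ∑ n ∈ Finset.Icc 1 (2 ^ k), |f (S n x)|
      ≤ ∑ n ∈ Finset.Icc 1 (2 ^ k), (1 / ((r : ℝ) + 1) * (k : ℝ) ^ (1 / p) +
          largePart (1 / ((r : ℝ) + 1) * (k : ℝ) ^ (1 / p)) (f (S n x))) :=
        Finset.sum_le_sum fun n _ => abs_le_add_largePart (by positivity) _
    _ = 2 ^ k * (1 / ((r : ℝ) + 1) * (k : ℝ) ^ (1 / p)) + ∑ n ∈ Finset.Icc 1 (2 ^ k),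
          largePart (1 / ((r : ℝ) + 1) * (k : ℝ) ^ (1 / p)) (f (S n x)) := by
        rw [Finset.sum_add_distrib, Finset.sum_const, Nat.card_Icc, nsmul_eq_mul]
        simp
    _ ≤ 2 ^ k * (ε / 2 * (k : ℝ) ^ (1 / p)) + (k : ℝ) ^ (1 / p) * 2 ^ k * (ε / 2) := by gcongr
    _ = _ := by ring

end

theorem MeasureTheory.MeasurePreserving.equiv_zpow {X : Type*} [MeasurableSpace X] {μ : Measure X}
    {T : X ≃ᵐ X} (hT : MeasurePreserving T μ μ) (n : ℤ) :
    MeasurePreserving (T.toEquiv ^ n : Equiv.Perm X) μ μ := by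
  have hpow : ∀ (e : X ≃ᵐ X), MeasurePreserving e μ μ → ∀ m : ℕ,
      MeasurePreserving (e.toEquiv ^ m : Equiv.Perm X) μ μ := by
    intro e he m
    rw [show ⇑(e.toEquiv ^ m : Equiv.Perm X) = e^[m] from Equiv.Perm.iterate_eq_pow e.toEquiv m ▸ rfl]
    exact he.iterate m
  cases n with
  | ofNat m => simpa using hpow T hT m
  | negSucc m =>
    rw [zpow_negSucc, ← inv_pow]
    exact hpow T.symm (hT.symm T) (m + 1)

/-! ### Colourings, sweeping sets and Rokhlin heights for aperiodic maps. -/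

section

variable {X : Type*} [MeasurableSpace X] {μ : Measure X} {T : X → X}

/-- A measurable colouring with countably many colours for which almost every point has a
colour different from those of its next `n` iterates. -/
theorem exists_measurable_coloring [MeasurableSpace.CountablySeparated X]
    (hT : Measurable T) (hap : IsAperiodic T μ) (n : ℕ) :
    ∃ k : X → ℕ, Measurable k ∧ ∀ᵐ x ∂μ, ∀ i, 1 ≤ i → i ≤ n → k x ≠ k (T^[i] x) := by
  classical
  obtain ⟨g, hgm, hgi⟩ := MeasurableSpace.measurable_injection_nat_bool_of_countablySeparated X
  have hcoord : ∀ (i j : ℕ), Measurable fun x => g (T^[i] x) j := fun i j =>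
    (measurable_pi_apply j).comp (hgm.comp (hT.iterate i))
  -- The first `m` binary coordinates already separate `x` from its next `n` iterates; then no such
  -- iterate lies in the same cylinder of length `m`.
  set D : ℕ → X → Prop := fun m x => ∀ i, 1 ≤ i → i ≤ n → ∃ j < m, g x j ≠ g (T^[i] x) j
  have hDm : ∀ m, MeasurableSet {x | D m x} := by
    intro m
    have : {x | D m x} = ⋂ (i : ℕ) (_ : 1 ≤ i) (_ : i ≤ n), ⋃ (j : ℕ) (_ : j < m),
        {x | g x j = g (T^[i] x) j}ᶜ := by
      ext x; simp [D]
    rw [this]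
    refine .iInter fun i => .iInter fun _ => .iInter fun _ => .iUnion fun j => .iUnion fun _ => ?_
    exact (measurableSet_eq_fun (hcoord 0 j) (hcoord i j)).compl
  set C : List Bool → Set X := fun l => {x | D l.length x ∧ ∀ j (hj : j < l.length), g x j = l[j]}
  have hCm : ∀ l, MeasurableSet (C l) := by
    intro l
    have : C l = {x | D l.length x} ∩ ⋂ (j : ℕ) (hj : j < l.length), {x | g x j = l[j]} := by
      ext x; simp [C]
    rw [this]
    refine (hDm _).inter (.iInter fun j => .iInter fun hj => ?_)
    exact measurableSet_eq_fun (hcoord 0 j) measurable_const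
  have hCd : ∀ l x i, 1 ≤ i → i ≤ n → x ∈ C l → T^[i] x ∉ C l := by
    rintro l x i h1 h2 ⟨hD, hx⟩ ⟨-, hx'⟩
    obtain ⟨j, hj, hne⟩ := hD i h1 h2
    exact hne ((hx j hj).trans (hx' j hj).symm)
  obtain ⟨e, he⟩ := exists_surjective_nat (List Bool)
  set P : X → ℕ → Prop := fun x m => x ∈ C (e m) with hP
  have hPm : ∀ m, MeasurableSet {x | P x m} := fun m => hCm _
  -- The colour is the index of the first admissible cylinder containing `x`; `0` is kept for points
  -- in none, a null set by aperiodicity.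
  set k : X → ℕ := fun x => if h : ∃ m, P x m then Nat.find h + 1 else 0 with hk
  have hk0 : ∀ x, (∃ m, P x m) → ∀ y, k x = k y → ∃ m, P x m ∧ P y m := by
    intro x hx y hxy
    by_cases hy : ∃ m, P y m
    · simp only [hk, dif_pos hx, dif_pos hy] at hxy
      refine ⟨Nat.find hx, Nat.find_spec hx, ?_⟩
      rw [Nat.add_right_cancel hxy]
      exact Nat.find_spec hy
    · simp [hk, dif_pos hx, dif_neg hy] at hxy
  refine ⟨k, ?_, ?_⟩
  · refine measurable_to_countable' fun v => ?_
    cases v with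
    | zero =>
      have : k ⁻¹' {0} = ⋂ m, {x | P x m}ᶜ := by
        ext x; simp [hk]
      rw [this]
      exact .iInter fun m => (hPm m).compl
    | succ v =>
      have : k ⁻¹' {v + 1} = {x | P x v} ∩ ⋂ (m : ℕ) (_ : m < v), {x | P x m}ᶜ := by
        ext x
        simp only [Set.mem_preimage, Set.mem_singleton_iff, Set.mem_inter_iff, Set.mem_ofPred_eq,
          Set.mem_iInter, Set.mem_compl_iff, hk]
        split_ifs with h
        · rw [Nat.add_right_cancel_iff, Nat.find_eq_iff]
        · constructor
          · intro h'; cases h'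
          · intro h'; exact absurd ⟨v, h'.1⟩ h
      rw [this]
      exact (hPm v).inter (.iInter fun m => .iInter fun _ => (hPm m).compl)
  · have hnp : ∀ᵐ x ∂μ, x ∉ Function.periodicPts T := measure_eq_zero_iff_ae_notMem.1 hap
    filter_upwards [hnp] with x hx i h1 h2 heq
    have hne : ∀ i, 1 ≤ i → ∃ j, g x j ≠ g (T^[i] x) j := by
      intro i hi
      by_contra! h
      exact hx (Function.mk_mem_periodicPts hi (hgi (funext fun j => (h j).symm)))
    have : ∀ i : ℕ, ∃ j, 1 ≤ i → g x j ≠ g (T^[i] x) j := fun i => by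
      by_cases hi : 1 ≤ i
      · obtain ⟨j, hj⟩ := hne i hi; exact ⟨j, fun _ => hj⟩
      · exact ⟨0, fun h => absurd h hi⟩
    choose J hJ using this
    set m := (Finset.range (n + 1)).sup J + 1
    have hD : D m x := fun i h1 h2 => ⟨J i,
      Nat.lt_succ_of_le (Finset.le_sup (f := J) (Finset.mem_range.2 (by omega))), hJ i h1⟩
    have hx0 : ∃ v, P x v := by
      obtain ⟨v, hv⟩ := he (List.ofFn fun j : Fin m => g x j)
      refine ⟨v, ?_⟩
      simp only [hP, hv]
      exact ⟨by rwa [List.length_ofFn], fun j hj => by rw [List.getElem_ofFn]⟩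
    obtain ⟨v, hv, hv'⟩ := hk0 x hx0 _ heq
    exact hCd _ x i h1 h2 hv hv'

/-- A small set that is visited by almost every orbit of an aperiodic transformation. -/
theorem exists_small_sweeping_set [MeasurableSpace.CountablySeparated X] [IsProbabilityMeasure μ]
    (hT : MeasurePreserving T μ μ) (hap : IsAperiodic T μ) (n : ℕ) :
    ∃ A : Set X, MeasurableSet A ∧ (n + 1) * μ A ≤ 1 ∧ ∀ᵐ x ∂μ, ∃ i, T^[i] x ∈ A := by
  obtain ⟨k, hkm, hk⟩ := exists_measurable_coloring hT.measurable hap n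
  -- The colour at time `n` is a strict minimum over the window `[0, 2 * n]`. Two visits to `A` at
  -- most `n` apart would each beat the other, so the first `n + 1` preimages of `A` are disjoint.
  set A : Set X := {x | ∀ j, j ≤ 2 * n → j ≠ n → k (T^[n] x) < k (T^[j] x)} with hA
  have hAm : MeasurableSet A := by
    have : A = ⋂ (j : ℕ) (_ : j ≤ 2 * n) (_ : j ≠ n), {x | k (T^[n] x) < k (T^[j] x)} := by
      ext x; simp [hA]
    rw [this]
    exact .iInter fun j => .iInter fun _ => .iInter fun _ => measurableSet_lt
      (hkm.comp (hT.measurable.iterate n)) (hkm.comp (hT.measurable.iterate j))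
  have hdisj : ∀ x i, 1 ≤ i → i ≤ n → x ∈ A → T^[i] x ∉ A := by
    intro x i h1 h2 hx hx'
    have a := hx (n + i) (by omega) (by omega)
    have b := hx' (n - i) (by omega) (by omega)
    rw [← Function.iterate_add_apply, ← Function.iterate_add_apply,
      show n - i + i = n by omega] at b
    exact lt_asymm a b
  refine ⟨A, hAm, ?_, ?_⟩
  · have hpd : Set.PairwiseDisjoint (↑(Finset.range (n + 1)) : Set ℕ) fun i => T^[i] ⁻¹' A := by
      have key : ∀ i j, i < j → j ≤ n → Disjoint (T^[i] ⁻¹' A) (T^[j] ⁻¹' A) := by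
        intro i j hij hj
        refine Set.disjoint_left.2 fun x hi hj' => hdisj (T^[i] x) (j - i) (by omega) (by omega) hi ?_
        rw [← Function.iterate_add_apply, Nat.sub_add_cancel hij.le]
        exact hj'
      intro i hi j hj hij
      simp only [Finset.coe_range, Set.mem_Iio] at hi hj
      rcases lt_or_gt_of_ne hij with h | h
      · exact key i j h (by omega)
      · exact (key j i h (by omega)).symm
    have := measure_biUnion_finset hpd
      (fun i _ => hT.measurable.iterate i hAm) (μ := μ)
    simp only [(hT.iterate _).measure_preimage hAm.nullMeasurableSet, Finset.sum_const,
      Finset.card_range, nsmul_eq_mul] at this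
    push_cast at this
    rw [← this]
    exact prob_le_one
  · have hall : ∀ᵐ x ∂μ, ∀ s, ∀ i, 1 ≤ i → i ≤ n → k (T^[s] x) ≠ k (T^[i] (T^[s] x)) :=
      ae_all_iff.2 fun s => (hT.iterate s).quasiMeasurePreserving.ae hk
    -- Poincaré recurrence: the least colour on the orbit recurs at some time `i ≥ n`, leaving room
    -- for a window centred there. The colouring rules out ties.
    have hrec : ∀ᵐ x ∂μ, ∀ v s, T^[s] x ∈ k ⁻¹' {v} → ∃ᶠ m in atTop, T^[m] x ∈ k ⁻¹' {v} :=
      ae_all_iff.2 fun v => hT.conservative.ae_forall_image_mem_imp_frequently_image_mem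
        (hkm (measurableSet_singleton v)).nullMeasurableSet
    filter_upwards [hall, hrec] with x hx hr
    have hex : ∃ v s, k (T^[s] x) = v := ⟨_, 0, rfl⟩
    classical
    obtain ⟨s, hs⟩ := Nat.find_spec hex
    have hmin : ∀ i, Nat.find hex ≤ k (T^[i] x) := fun i => Nat.find_min' hex ⟨i, rfl⟩
    obtain ⟨i, hni, hi⟩ := frequently_atTop.1 (hr _ s hs) n
    simp only [Set.mem_preimage, Set.mem_singleton_iff] at hi
    refine ⟨i - n, fun j hj hjn => ?_⟩
    rw [← Function.iterate_add_apply, ← Function.iterate_add_apply,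
      show n + (i - n) = i by omega]
    refine lt_of_le_of_ne (hi ▸ hmin _) ?_
    rcases lt_or_gt_of_ne hjn with h | h
    · have := hx (j + (i - n)) (n - j) (by omega) (by omega)
      rw [← Function.iterate_add_apply, show n - j + (j + (i - n)) = i by omega] at this
      exact this.symm
    · have := hx i (j - n) (by omega) (by omega)
      rwa [← Function.iterate_add_apply, show j - n + i = j + (i - n) by omega] at this

/-- A Rokhlin-type height function: `pos` takes values in `{0, …, H - 1}`, decreases by one along
orbits until it reaches `0`, and is nearly uniformly distributed. -/
theorem exists_height_function [MeasurableSpace.CountablySeparated X] [IsProbabilityMeasure μ]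
    (hT : MeasurePreserving T μ μ) (hap : IsAperiodic T μ) {H : ℕ} (hH : 0 < H) :
    ∃ pos : X → ℕ, Measurable pos ∧ (∀ x, pos x < H) ∧
      (∀ᵐ x ∂μ, ∀ j ≤ pos x, pos (T^[j] x) = pos x - j) ∧
      ∀ i < H, H * μ (pos ⁻¹' {i}) ≤ 2 := by
  classical
  -- The exponent 2 pays for `H` levels, each losing up to `H * μ A` in the comparison of level
  -- measures.
  obtain ⟨A, hAm, hAs, hAh⟩ := exists_small_sweeping_set hT hap (H ^ 2)
  set τ : X → ℕ := fun x => if h : ∃ i, T^[i] x ∈ A then Nat.find h else 0 with hτ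
  have hiter : ∀ i, MeasurableSet {x | T^[i] x ∈ A} := fun i => hT.measurable.iterate i hAm
  have hτm : Measurable τ := by
    refine measurable_to_countable' fun v => ?_
    have : τ ⁻¹' {v} = ({x | T^[v] x ∈ A} ∩ ⋂ (m : ℕ) (_ : m < v), {x | T^[m] x ∈ A}ᶜ) ∪
        ((⋂ m, {x | T^[m] x ∈ A}ᶜ) ∩ {_x | v = 0}) := by
      ext x
      simp only [Set.mem_preimage, Set.mem_singleton_iff, Set.mem_inter_iff, Set.mem_ofPred_eq,
        Set.mem_iInter, Set.mem_compl_iff, Set.mem_union, hτ]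
      split_ifs with h
      · rw [Nat.find_eq_iff]
        refine ⟨Or.inl, ?_⟩
        rintro (h' | h')
        · exact h'
        · obtain ⟨i, hi⟩ := h; exact absurd hi (h'.1 i)
      · push Not at h
        refine ⟨fun h' => Or.inr ⟨h, h'.symm⟩, ?_⟩
        rintro (h' | h')
        · exact absurd h'.1 (h v)
        · exact h'.2.symm
    rw [this]
    refine ((hiter v).inter (.iInter fun m => .iInter fun _ => (hiter m).compl)).union
      ((MeasurableSet.iInter fun m => (hiter m).compl).inter ?_)
    by_cases hv : v = 0 <;> simp [hv]
  have hstep : ∀ x, (∃ i, T^[i] x ∈ A) → τ x ≠ 0 →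
      (∃ i, T^[i] (T x) ∈ A) ∧ τ (T x) + 1 = τ x := by
    intro x hx h0
    have h0A : ¬ T^[0] x ∈ A := fun h => h0 (by simp only [hτ, dif_pos hx]; exact (Nat.find_eq_zero hx).2 h)
    have hTx : ∃ i, T^[i] (T x) ∈ A := by
      obtain ⟨i, hi⟩ := hx
      cases i with
      | zero => exact absurd hi h0A
      | succ i => exact ⟨i, hi⟩
    refine ⟨hTx, ?_⟩
    simp only [hτ, dif_pos hx, dif_pos hTx]
    exact (Nat.find_comp_succ hx hTx h0A).symm
  -- The time to reach `A`, modulo `H`: it can fail to count down cyclically only at points of `A`.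
  set pos : X → ℕ := fun x => τ x % H with hpos
  have hposm : Measurable pos := (measurable_of_countable (· % H)).comp hτm
  have hpstep : ∀ x, (∃ i, T^[i] x ∈ A) → pos x ≠ 0 →
      (∃ i, T^[i] (T x) ∈ A) ∧ pos (T x) + 1 = pos x := by
    intro x hx h0
    have hτ0 : τ x ≠ 0 := fun h => h0 (by simp [hpos, h])
    obtain ⟨h1, h2⟩ := hstep x hx hτ0
    refine ⟨h1, ?_⟩
    simp only [hpos] at h0 ⊢
    rw [← h2] at h0 ⊢
    have hlt := Nat.mod_lt (τ (T x)) hH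
    rw [Nat.add_mod] at h0 ⊢
    rcases Nat.lt_or_ge 1 H with hH1 | hH1
    · rw [Nat.mod_eq_of_lt hH1] at h0 ⊢
      rcases Nat.lt_or_ge (τ (T x) % H + 1) H with h | h
      · rw [Nat.mod_eq_of_lt h]
      · rw [show τ (T x) % H + 1 = H by omega, Nat.mod_self] at h0
        exact absurd rfl h0
    · obtain rfl : H = 1 := by omega
      simp [Nat.mod_one] at h0
  have hpj : ∀ j x, (∃ i, T^[i] x ∈ A) → j ≤ pos x → pos (T^[j] x) = pos x - j := by
    intro j
    induction j with
    | zero => intro x _ _; rfl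
    | succ j ih =>
      intro x hx hj
      obtain ⟨h1, h2⟩ := hpstep x hx (by omega)
      rw [Function.iterate_succ_apply, ih (T x) h1 (by omega)]
      omega
  refine ⟨pos, hposm, fun x => Nat.mod_lt _ hH, ?_, ?_⟩
  · filter_upwards [hAh] with x hx j hj using hpj j x hx hj
  · have hms : ∀ i, MeasurableSet (pos ⁻¹' {i}) := fun i => hposm (measurableSet_singleton i)
    have hinv : ∀ i, μ (T ⁻¹' (pos ⁻¹' {i})) = μ (pos ⁻¹' {i}) := fun i =>
      hT.measure_preimage (hms i).nullMeasurableSet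
    have hdec : ∀ i, μ (pos ⁻¹' {i + 1}) ≤ μ (pos ⁻¹' {i}) := by
      intro i
      rw [← hinv i]
      refine measure_mono_ae ?_
      filter_upwards [hAh] with x hx hxi
      have hxi : pos x = i + 1 := hxi
      have := (hpstep x hx (by omega)).2
      show pos (T x) = i
      omega
    have hanti : Antitone fun i => μ (pos ⁻¹' {i}) := antitone_nat_of_succ_le hdec
    have hinc : ∀ i, i + 1 < H → μ (pos ⁻¹' {i}) ≤ μ (pos ⁻¹' {i + 1}) + μ A := by
      intro i hi
      rw [← hinv i]
      refine (measure_mono_ae ?_).trans (measure_union_le (pos ⁻¹' {i + 1}) A)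
      filter_upwards [hAh] with x hx hxi
      have hxi : pos (T x) = i := hxi
      by_cases hxA : x ∈ A
      · exact Or.inr hxA
      · have hτ0 : τ x ≠ 0 := by
          simp only [hτ, dif_pos hx]
          exact fun h => hxA ((Nat.find_eq_zero hx).1 h)
        have h2 := (hstep x hx hτ0).2
        left
        show pos x = i + 1
        simp only [hpos] at hxi ⊢
        rw [← h2, Nat.add_mod, hxi, Nat.mod_eq_of_lt (show 1 < H by omega), Nat.mod_eq_of_lt hi]
    have hzero : ∀ i < H, μ (pos ⁻¹' {0}) ≤ μ (pos ⁻¹' {i}) + i * μ A := by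
      intro i
      induction i with
      | zero => intro _; simp
      | succ i ih =>
        intro hi
        refine (ih (by omega)).trans ((add_le_add_left (hinc i hi) _).trans (le_of_eq ?_))
        push_cast; ring
    have hsum : ∑ i ∈ Finset.range H, μ (pos ⁻¹' {i}) ≤ 1 := by
      rw [← measure_biUnion_finset (fun i _ j _ hij => ?_) fun i _ => hms i]
      · exact prob_le_one
      · exact Disjoint.preimage _ (Set.disjoint_singleton.2 hij)
    have h0 : H * μ (pos ⁻¹' {0}) ≤ 2 := by
      calc (H : ENNReal) * μ (pos ⁻¹' {0}) = ∑ i ∈ Finset.range H, μ (pos ⁻¹' {0}) := by simp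
        _ ≤ ∑ i ∈ Finset.range H, (μ (pos ⁻¹' {i}) + H * μ A) := by
            refine Finset.sum_le_sum fun i hi => (hzero i (Finset.mem_range.1 hi)).trans ?_
            gcongr
            exact (Finset.mem_range.1 hi).le
        _ = ∑ i ∈ Finset.range H, μ (pos ⁻¹' {i}) + (H ^ 2 : ℕ) * μ A := by
            rw [Finset.sum_add_distrib]; simp; ring
        _ ≤ 1 + 1 := by
            gcongr
            refine le_trans ?_ hAs
            gcongr
            exact le_self_add
        _ = 2 := one_add_one_eq_two
    intro i _
    exact le_trans (mul_le_mul' le_rfl (hanti (Nat.zero_le i))) h0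

end

/-! ### Base-4 digit blocks and the `ZMod 3` colouring. -/

/-- The `j`-th digit block of `i`, where the base-`4` digits with index in
`[L * 2 ^ (j + 1), L * 2 ^ (j + 2))` form the `j`-th block. -/
def digitBlock (L j i : ℕ) : ℕ := i / 4 ^ (L * 2 ^ (j + 1)) % 4 ^ (L * 2 ^ (j + 1))

theorem digitBlock_sub {L j i s : ℕ} (hs : s ≤ digitBlock L j i) :
    digitBlock L j (i - 4 ^ (L * 2 ^ (j + 1)) * s) = digitBlock L j i - s := by
  unfold digitBlock at *
  set Q := 4 ^ (L * 2 ^ (j + 1))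
  have hQ : 0 < Q := by positivity
  rw [Nat.sub_mul_div]
  have hlt := Nat.mod_lt (i / Q) hQ
  conv_lhs => rw [← Nat.div_add_mod (i / Q) Q]
  rw [Nat.add_sub_assoc hs, Nat.mul_add_mod, Nat.mod_eq_of_lt (by omega)]

theorem digitBlock_sub_of_lt {L j j' i : ℕ} (s : ℕ) (hj : j' < j)
    (hs : 4 ^ (L * 2 ^ (j + 1)) * s ≤ i) :
    digitBlock L j' (i - 4 ^ (L * 2 ^ (j + 1)) * s) = digitBlock L j' i := by
  unfold digitBlock
  set Q := 4 ^ (L * 2 ^ (j' + 1))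
  obtain ⟨t, ht⟩ : Q * Q ∣ 4 ^ (L * 2 ^ (j + 1)) := by
    rw [← pow_add, ← mul_add, ← mul_two, ← pow_succ]
    exact pow_dvd_pow _ (Nat.mul_le_mul_left _ (Nat.pow_le_pow_right (by norm_num) (by omega)))
  rw [ht, mul_assoc] at hs ⊢
  rw [← Nat.mod_mul_right_div_self, Nat.sub_mul_mod hs, Nat.mod_mul_right_div_self]

/-- The hypothesis on `s` means that the subtraction borrows nothing from higher digits. -/
theorem digitBlock_sub_of_gt {L j j' i s : ℕ} (hj : j < j') (hs : s ≤ digitBlock L j i) :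
    digitBlock L j' (i - 4 ^ (L * 2 ^ (j + 1)) * s) = digitBlock L j' i := by
  unfold digitBlock at *
  set Q := 4 ^ (L * 2 ^ (j + 1))
  have hQ : 0 < Q := by positivity
  obtain ⟨t, ht⟩ : Q * Q ∣ 4 ^ (L * 2 ^ (j' + 1)) := by
    rw [← pow_add, ← mul_add, ← mul_two, ← pow_succ]
    exact pow_dvd_pow _ (Nat.mul_le_mul_left _ (Nat.pow_le_pow_right (by norm_num) (by omega)))
  have hlt := Nat.mod_lt (i / Q) hQ
  have key : (i / Q - s) / Q = i / Q / Q := by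
    have e : i / Q - s = Q * (i / Q / Q) + (i / Q % Q - s) := by
      rw [← Nat.add_sub_assoc hs, Nat.div_add_mod]
    rw [e, Nat.mul_add_div hQ, Nat.div_eq_of_lt (lt_of_le_of_lt (Nat.sub_le _ _) hlt), add_zero]
  rw [ht, ← Nat.div_div_eq_div_mul, ← Nat.div_div_eq_div_mul, Nat.sub_mul_div, key,
    ← Nat.div_div_eq_div_mul, ← Nat.div_div_eq_div_mul]

theorem mul_le_of_le_digitBlock {L j i s : ℕ} (hs : s ≤ digitBlock L j i) :
    4 ^ (L * 2 ^ (j + 1)) * s ≤ i :=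
  (Nat.mul_le_mul_left _ (hs.trans (Nat.mod_le _ _))).trans (Nat.mul_div_le _ _)

/-- The sum of the vectors `v j`, weighted with the digit blocks of `i`. -/
def digitSum {G : Type*} [AddCommGroup G] (L : ℕ) (v : Fin L → G) (i : ℕ) : G :=
  ∑ j : Fin L, digitBlock L j i • v j

theorem four_pow_nsmul {G : Type*} [AddCommGroup G] {g : G} (hg : 3 • g = 0) (r : ℕ) :
    4 ^ r • g = g := by
  induction r with
  | zero => simp
  | succ r ih => rw [pow_succ, mul_nsmul, ih, show 4 = 3 + 1 from rfl, add_nsmul, hg]; simp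

/-- `4 ^ m` is a unit of block `j` times `4 ^ r` with `r < L * 2 ^ j`. Block `j` can absorb the
subtraction, the other blocks are untouched, and `4 ^ r` acts as `1` on a group of exponent 3. -/
theorem digitSum_sub_four_pow {G : Type*} [AddCommGroup G] (hG : ∀ g : G, 3 • g = 0) {L : ℕ}
    (v : Fin L → G) {i : ℕ} (j : Fin L) (hD : 4 ^ (L * 2 ^ (j : ℕ)) ≤ digitBlock L j i) {m : ℕ}
    (hm : 2 * L * 2 ^ (j : ℕ) ≤ m) (hm' : m < 3 * L * 2 ^ (j : ℕ)) :
    4 ^ m ≤ i ∧ digitSum L v (i - 4 ^ m) = digitSum L v i - v j := by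
  obtain ⟨r, rfl⟩ := Nat.exists_eq_add_of_le hm
  have hpow : 4 ^ (2 * L * 2 ^ (j : ℕ) + r) = 4 ^ (L * 2 ^ ((j : ℕ) + 1)) * 4 ^ r := by
    rw [pow_add, pow_succ]; congr 2; ring
  have hs : 4 ^ r ≤ digitBlock L j i := by
    refine le_trans (Nat.pow_le_pow_right (by norm_num) ?_) hD
    have : 3 * L * 2 ^ (j : ℕ) = 2 * L * 2 ^ (j : ℕ) + L * 2 ^ (j : ℕ) := by ring
    omega
  have hle := mul_le_of_le_digitBlock hs
  rw [hpow]
  refine ⟨hle, ?_⟩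
  unfold digitSum
  rw [eq_sub_iff_add_eq, ← Finset.add_sum_erase _ _ (Finset.mem_univ j),
    ← Finset.add_sum_erase _ _ (Finset.mem_univ j), digitBlock_sub hs, add_right_comm]
  congr 1
  · conv_rhs => rw [← Nat.sub_add_cancel hs, add_nsmul, four_pow_nsmul (hG _)]
  · refine Finset.sum_congr rfl fun j' hj' => ?_
    have hne : (j' : ℕ) ≠ j := fun h => (Finset.ne_of_mem_erase hj') (Fin.ext h)
    rcases lt_or_gt_of_ne hne with h | h
    · rw [digitBlock_sub_of_lt _ h hle]
    · rw [digitBlock_sub_of_gt h hs]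

/-- With `q = 4 ^ (L * 2 ^ j)`, block `j` takes `q * q` values, so a proportion `1 / q` of all `i`
has it below `q`. -/
theorem card_digitBlock_lt_mul_le {L j : ℕ} (hj : j < L) :
    ((Finset.range (4 ^ (L * 2 ^ (L + 1)))).filter
      fun i => digitBlock L j i < 4 ^ (L * 2 ^ j)).card * 4 ^ (L * 2 ^ j)
      ≤ 4 ^ (L * 2 ^ (L + 1)) := by
  set q := 4 ^ (L * 2 ^ j) with hq
  have hq0 : 0 < q := by positivity
  have hQ : 4 ^ (L * 2 ^ (j + 1)) = q * q := by rw [hq, ← pow_add]; congr 1; ring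
  obtain ⟨t, ht⟩ : (q * q) * (q * q) ∣ 4 ^ (L * 2 ^ (L + 1)) := by
    rw [← hQ, ← pow_add, ← mul_add, ← mul_two, ← pow_succ]
    exact pow_dvd_pow _ (Nat.mul_le_mul_left _ (Nat.pow_le_pow_right (by norm_num) (by omega)))
  have hcard : ((Finset.range (4 ^ (L * 2 ^ (L + 1)))).filter
      fun i => digitBlock L j i < q).card ≤ (Finset.range (q * q * q) ×ˢ Finset.range t).card := by
    refine Finset.card_le_card_of_injOn (fun i => (i % (q * q * (q * q)), i / (q * q * (q * q))))
      ?_ ?_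
    · intro i hi
      simp only [Finset.coe_filter, Finset.mem_range, Set.mem_ofPred_eq] at hi
      obtain ⟨h1, h2⟩ := hi
      simp only [Finset.coe_product, Set.mem_prod, Finset.mem_coe, Finset.mem_range]
      constructor
      · rw [digitBlock, hQ, ← Nat.mod_mul_right_div_self, Nat.div_lt_iff_lt_mul (by positivity)] at h2
        calc _ < q * (q * q) := h2
          _ = _ := by ring
      · exact Nat.div_lt_of_lt_mul (ht ▸ h1)
    · intro a _ b _ hab
      simp only [Prod.mk.injEq] at hab
      rw [← Nat.div_add_mod a (q * q * (q * q)), ← Nat.div_add_mod b (q * q * (q * q)), hab.1, hab.2]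
  rw [Finset.card_product, Finset.card_range, Finset.card_range] at hcard
  calc _ ≤ q * q * q * t * q := Nat.mul_le_mul_right _ hcard
    _ = q * q * (q * q) * t := by ring
    _ = _ := ht.symm

/-! ### A small set absorbing whole blocks of times. -/

section

variable {X : Type*} [MeasurableSpace X] {μ : Measure X} {T : X → X}

/-- A set of measure at most `3⁻ᵈ` such that most orbits stay in it during one of `3ᵈ` blocks
of times `4 ^ m`. -/
theorem exists_set_containing_block [MeasurableSpace.CountablySeparated X]
    [IsProbabilityMeasure μ] (hT : MeasurePreserving T μ μ) (hap : IsAperiodic T μ) (d : ℕ) :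
    ∃ E B : Set X, MeasurableSet E ∧ (3 ^ d : ℕ) * μ E ≤ 1 ∧
      μ B ≤ (3 ^ d : ℕ) * (2 / (4 ^ 3 ^ d : ℕ)) ∧
      ∀ x ∉ B, ∃ j < 3 ^ d, ∀ m, 2 * 3 ^ d * 2 ^ j ≤ m → m < 3 * 3 ^ d * 2 ^ j →
        T^[4 ^ m] x ∈ E := by
  classical
  set L := 3 ^ d with hL
  set G := Fin d → ZMod 3
  have hGc : Fintype.card G = L := by simp [G, hL, ZMod.card]
  let v : Fin L ≃ G := (Fintype.equivFinOfCardEq hGc).symm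
  have hG : ∀ g : G, 3 • g = 0 := by
    intro g; ext a
    change 3 • g a = 0
    generalize g a = z
    revert z; decide
  -- Just enough digits for the last block, `j = L - 1`.
  set H := 4 ^ (L * 2 ^ (L + 1)) with hH
  have hH0 : 0 < H := by positivity
  obtain ⟨pos, hpm, hpH, hps, hpu⟩ := exists_height_function hT hap hH0
  set c : ℕ → G := digitSum L v
  have hcm : ∀ u, MeasurableSet (pos ⁻¹' (c ⁻¹' {u})) := fun u => hpm (Set.to_countable _).measurableSet
  -- Pigeonhole over the `L` colour classes.
  obtain ⟨u, hu⟩ : ∃ u, (L : ENNReal) * μ (pos ⁻¹' (c ⁻¹' {u})) ≤ 1 := by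
    by_contra! hcon
    have h1 := ENNReal.sum_lt_sum_of_nonempty (s := (Finset.univ : Finset G))
      Finset.univ_nonempty fun u _ => hcon u
    rw [← Finset.mul_sum, ← measure_biUnion_finset (fun a _ b _ hab => ?_) fun u _ => hcm u] at h1
    · have h2 : (L : ENNReal) * μ (⋃ b ∈ Finset.univ, pos ⁻¹' (c ⁻¹' {b})) ≤ L * 1 := by
        gcongr; exact prob_le_one
      rw [Finset.sum_const, Finset.card_univ, hGc, nsmul_eq_mul] at h1
      exact absurd h2 (not_le.2 h1)
    · exact Disjoint.preimage _ (Disjoint.preimage _ (Set.disjoint_singleton.2 hab))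
  set bad : ℕ → Finset ℕ := fun j =>
    (Finset.range H).filter fun i => digitBlock L j i < 4 ^ (L * 2 ^ j)
  have hbad : ∀ j < L, μ (pos ⁻¹' (bad j : Set ℕ)) ≤ 2 / (4 ^ L : ℕ) := by
    intro j hj
    have h1 : μ (pos ⁻¹' (bad j : Set ℕ)) ≤ ∑ i ∈ bad j, μ (pos ⁻¹' {i}) := by
      refine le_trans (measure_mono ?_) (measure_biUnion_finset_le _ _)
      intro x hx
      simpa using hx
    have h2 : ∀ i ∈ bad j, μ (pos ⁻¹' {i}) ≤ 2 / (H : ENNReal) := by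
      intro i hi
      rw [ENNReal.le_div_iff_mul_le (Or.inr (by norm_num)) (Or.inr (by norm_num)), mul_comm]
      exact hpu i (Finset.mem_range.1 (Finset.mem_filter.1 hi).1)
    have h3 := card_digitBlock_lt_mul_le hj
    have h4 : (4 : ℕ) ^ L ≤ 4 ^ (L * 2 ^ j) :=
      Nat.pow_le_pow_right (by norm_num) (Nat.le_mul_of_pos_right _ (by positivity))
    calc μ (pos ⁻¹' (bad j : Set ℕ)) ≤ ∑ i ∈ bad j, 2 / (H : ENNReal) :=
          h1.trans (Finset.sum_le_sum h2)
      _ = (bad j).card * (2 / (H : ENNReal)) := by simp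
      _ ≤ 2 / (4 ^ L : ℕ) := by
          rw [ENNReal.le_div_iff_mul_le (Or.inr (by norm_num)) (Or.inr (by norm_num)),
            mul_right_comm]
          calc ((bad j).card : ENNReal) * (4 ^ L : ℕ) * (2 / H) ≤ H * (2 / H) := by
                gcongr
                exact_mod_cast (Nat.mul_le_mul_left _ h4).trans h3
            _ ≤ 2 := ENNReal.mul_div_le
  refine ⟨pos ⁻¹' (c ⁻¹' {u}), {x | ¬ ∀ j ≤ pos x, pos (T^[j] x) = pos x - j} ∪
    ⋃ j ∈ Finset.range L, pos ⁻¹' (bad j : Set ℕ), hcm u, hu, ?_, ?_⟩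
  · refine (measure_union_le _ _).trans ?_
    rw [ae_iff.1 hps, zero_add]
    refine (measure_biUnion_finset_le _ _).trans ((Finset.sum_le_sum fun j hj =>
      hbad j (Finset.mem_range.1 hj)).trans (le_of_eq ?_))
    simp
  · intro x hx
    simp only [Set.mem_union, Set.mem_ofPred_eq, not_or, not_not, Set.mem_iUnion, not_exists] at hx
    obtain ⟨hx1, hx2⟩ := hx
    -- The block whose shift takes the colour of `x` to `u`.
    set j := v.symm (c (pos x) - u)
    have hD : 4 ^ (L * 2 ^ (j : ℕ)) ≤ digitBlock L j (pos x) := by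
      by_contra! hcon
      exact hx2 j (Finset.mem_range.2 j.2)
        (Finset.mem_coe.2 (Finset.mem_filter.2 ⟨Finset.mem_range.2 (hpH x), hcon⟩))
    refine ⟨j, j.2, fun m hm hm' => ?_⟩
    obtain ⟨h1, h2⟩ := digitSum_sub_four_pow hG v j hD hm hm'
    show digitSum L v (pos (T^[4 ^ m] x)) = u
    rw [hx1 _ h1, h2]
    simp [j, c]

end

/-! ### Part (2): building the function. -/

theorem log_six_mul_two_pow_le {L j : ℕ} (hj : j < L) :
    Real.log ((6 * (L * 2 ^ j) : ℕ) : ℝ) ≤ 3 * L := by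
  have hnat : 6 * (L * 2 ^ j) ≤ 2 ^ (4 * L) := by
    have h1 : L ≤ 2 ^ L := Nat.lt_two_pow_self.le
    have h2 : 2 ^ j * 2 ≤ 2 ^ L := by
      rw [← pow_succ]; exact Nat.pow_le_pow_right (by norm_num) hj
    have h3 : 3 ≤ 2 ^ (2 * L) := by
      calc 3 ≤ 2 ^ 2 := by norm_num
        _ ≤ _ := Nat.pow_le_pow_right (by norm_num) (by omega)
    calc 6 * (L * 2 ^ j) = 3 * (L * (2 ^ j * 2)) := by ring
      _ ≤ 2 ^ (2 * L) * (2 ^ L * 2 ^ L) := by gcongr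
      _ = _ := by ring
  have hpos : 0 < 6 * (L * 2 ^ j) := by
    have : 0 < L := by omega
    positivity
  calc Real.log ((6 * (L * 2 ^ j) : ℕ) : ℝ) ≤ Real.log ((2 : ℝ) ^ (4 * L)) :=
        Real.log_le_log (by exact_mod_cast hpos) (by exact_mod_cast hnat)
    _ = 4 * L * Real.log 2 := by rw [Real.log_pow]; push_cast; ring
    _ ≤ 4 * L * 0.75 := by
        gcongr
        linarith [Real.log_two_lt_d9]
    _ = 3 * L := by ring

theorem mul_two_div_four_pow_le {k L : ℕ} (hk : k ≤ L) :
    (L : ENNReal) * (2 / (4 ^ L : ℕ)) ≤ 2 * 2⁻¹ ^ k := by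
  have h : L * 2 ^ k ≤ 4 ^ L := by
    calc L * 2 ^ k ≤ 2 ^ L * 2 ^ L := by
          gcongr
          · exact Nat.lt_two_pow_self.le
          · norm_num
      _ = 4 ^ L := by rw [← mul_pow]; norm_num
  rw [← ENNReal.inv_pow, ← div_eq_mul_inv, ENNReal.le_div_iff_mul_le (Or.inr (by norm_num))
    (Or.inr (by norm_num)), mul_right_comm]
  calc (L : ENNReal) * 2 ^ k * (2 / (4 ^ L : ℕ)) ≤ (4 ^ L : ℕ) * (2 / (4 ^ L : ℕ)) := by
        gcongr
        exact_mod_cast h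
    _ ≤ 2 := ENNReal.mul_div_le

theorem limsup_coe_eq_top_of_frequently {u : ℕ → ℝ} (h : ∀ C : ℝ, ∃ᶠ N in atTop, C ≤ u N) :
    limsup (fun N => (u N : EReal)) atTop = ⊤ := by
  refine (EReal.eq_top_iff_forall_lt _).2 fun y => ?_
  refine lt_of_lt_of_le (EReal.coe_lt_coe_iff.2 (lt_add_one y)) ?_
  exact le_limsup_of_frequently_le ((h (y + 1)).mono fun N hN => EReal.coe_le_coe_iff.2 hN)

/-- Since `4 ^ m = 2 ^ (2 * m)`, the block occupies the even indices `n` in `[4 * R, 6 * R)`;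
positivity discards the rest. -/
theorem card_mul_le_ergodicSum_two_pow {X : Type*} [MeasurableSpace X] {T : X → X} {f : X → ℝ} (hf : ∀ x, 0 ≤ f x) {x : X} {R : ℕ}
    (hR : 0 < R) {b : ℝ} (hb : ∀ m, 2 * R ≤ m → m < 3 * R → b ≤ f (T^[4 ^ m] x)) :
    R * b ≤ ergodicSum T (fun n => 2 ^ n) f (6 * R) x := by
  unfold ergodicSum
  calc (R : ℝ) * b = ∑ m ∈ Finset.Ico (2 * R) (3 * R), b := by
        rw [Finset.sum_const, Nat.card_Ico, nsmul_eq_mul, show 3 * R - 2 * R = R by omega]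
    _ ≤ ∑ m ∈ Finset.Ico (2 * R) (3 * R), f (T^[2 ^ (2 * m)] x) := by
        refine Finset.sum_le_sum fun m hm => ?_
        rw [pow_mul]
        exact hb m (Finset.mem_Ico.1 hm).1 (Finset.mem_Ico.1 hm).2
    _ = ∑ n ∈ (Finset.Ico (2 * R) (3 * R)).image (2 * ·), f (T^[2 ^ n] x) := by
        rw [Finset.sum_image fun a _ b _ h => Nat.eq_of_mul_eq_mul_left two_pos h]
    _ ≤ _ := by
        refine Finset.sum_le_sum_of_subset_of_nonneg ?_ fun _ _ _ => hf _
        intro n hn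
        obtain ⟨m, hm, rfl⟩ := Finset.mem_image.1 hn
        rw [Finset.mem_Ico] at hm
        rw [Finset.mem_Icc]
        omega

/-- The gain `4 ^ k` in `M` beats the loss `2 ^ k` in the weight of the `k`-th set; `18 = 6 * 3`
comes from `N = 6 * R` and `log N ≤ 3 * L`. -/
theorem two_pow_div_le_of_block_bound {p : ℝ} (hp : 1 < p) {L j k : ℕ} (hj : j < L) {M S : ℝ} (hM : 0 < M)
    (hM' : M ≤ (4 ^ k)⁻¹ * (((6 * (L * 2 ^ j) : ℕ) : ℝ) *
      (Real.log ((6 * (L * 2 ^ j) : ℕ) : ℝ)) ^ (1 / p)))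
    (hS : ((L * 2 ^ j : ℕ) : ℝ) * ((2 ^ k)⁻¹ * L : ℝ) ^ (1 / p) ≤ S) :
    2 ^ k / 18 ≤ 1 / M * S := by
  have hp0 : 0 < p := by linarith
  have hs1 : 1 / p ≤ 1 := by rw [div_le_one hp0]; exact hp.le
  have hL : 0 < L := by omega
  set R : ℝ := ((L * 2 ^ j : ℕ) : ℝ) with hR
  have hRpos : 0 < R := by positivity
  set Λ : ℝ := (L : ℝ) ^ (1 / p)
  have hΛ : 0 < Λ := by positivity
  have h1 : (Real.log ((6 * (L * 2 ^ j) : ℕ) : ℝ)) ^ (1 / p) ≤ 3 * Λ := by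
    calc _ ≤ (3 * L : ℝ) ^ (1 / p) :=
          Real.rpow_le_rpow (Real.log_natCast_nonneg _) (log_six_mul_two_pow_le hj) (by positivity)
      _ = 3 ^ (1 / p) * Λ := Real.mul_rpow (by norm_num) (by positivity)
      _ ≤ 3 ^ (1 : ℝ) * Λ := by
          gcongr
          norm_num
      _ = 3 * Λ := by rw [Real.rpow_one]
  have h2 : (2 ^ k)⁻¹ * Λ ≤ ((2 ^ k)⁻¹ * L : ℝ) ^ (1 / p) := by
    rw [Real.mul_rpow (by positivity) (by positivity)]
    gcongr
    exact Real.self_le_rpow_of_le_one (by positivity) (inv_le_one_of_one_le₀ (one_le_pow₀ one_le_two)) hs1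
  have hMR : M ≤ (4 ^ k)⁻¹ * ((6 * R) * (3 * Λ)) := by
    refine hM'.trans ?_
    have : ((6 * (L * 2 ^ j) : ℕ) : ℝ) = 6 * R := by rw [hR]; push_cast; ring
    rw [this] at h1 ⊢
    gcongr
  rw [one_div_mul_eq_div, le_div_iff₀ hM]
  have h4 : (2 : ℝ) ^ k * (4 ^ k)⁻¹ = (2 ^ k)⁻¹ := by
    rw [show (4 : ℝ) = 2 * 2 by norm_num, mul_pow]
    field_simp
  calc 2 ^ k / 18 * M ≤ 2 ^ k / 18 * ((4 ^ k)⁻¹ * ((6 * R) * (3 * Λ))) := by gcongr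
    _ = R * ((2 ^ k * (4 ^ k)⁻¹) * Λ) := by ring
    _ = R * ((2 ^ k)⁻¹ * Λ) := by rw [h4]
    _ ≤ R * ((2 ^ k)⁻¹ * L : ℝ) ^ (1 / p) := by gcongr
    _ ≤ S := hS

section

variable {X : Type*} [MeasurableSpace X] {μ : Measure X} {T : X → X} {p : ℝ}

theorem exists_memLp_limsup_ergodicSum_two_pow_eq_top [MeasurableSpace.CountablySeparated X]
    [IsProbabilityMeasure μ] (hp : 1 < p) (hT : MeasurePreserving T μ μ) (hap : IsAperiodic T μ)
    {M : ℕ → ℝ} (hM : ∀ᶠ N in atTop, 0 < M N)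
    (hM0 : Tendsto (fun N : ℕ => M N / ((N : ℝ) * (Real.log N) ^ (1 / p))) atTop (𝓝 0)) :
    ∃ f : X → ℝ, MemLp f (ENNReal.ofReal p) μ ∧ ∀ᵐ x ∂μ, limsup
      (fun N : ℕ => ((1 / M N * ergodicSum T (fun n => 2 ^ n) f N x : ℝ) : EReal)) atTop = ⊤ := by
  have hp0 : 0 < p := by linarith
  have hchoice : ∀ k : ℕ, ∃ d : ℕ, k ≤ d ∧ ∀ N ≥ d, 0 < M N ∧
      M N ≤ (4 ^ k)⁻¹ * ((N : ℝ) * (Real.log N) ^ (1 / p)) := by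
    intro k
    have h4 : (0 : ℝ) < (4 ^ k)⁻¹ := by positivity
    obtain ⟨d, hd⟩ := eventually_atTop.1
      ((hM.and (hM0.eventually_lt_const h4)).and (eventually_ge_atTop 2))
    refine ⟨max k d, le_max_left _ _, fun N hN => ?_⟩
    obtain ⟨⟨h1, h2⟩, h3⟩ := hd N ((le_max_right _ _).trans hN)
    have hlog : 0 < Real.log N := Real.log_pos (by exact_mod_cast h3)
    have hN0 : (0 : ℝ) < N := by positivity
    exact ⟨h1, ((div_lt_iff₀ (by positivity)).1 h2).le⟩
  choose d hkd hd using hchoice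
  choose E B hE hEμ hBμ hB using fun k => exists_set_containing_block (μ := μ) hT hap (d k)
  have hdL : ∀ k, d k ≤ 3 ^ d k := fun k => (Nat.lt_pow_self (by norm_num)).le
  -- `F` is the `p`-th power of the desired function; each normalised indicator has integral at most
  -- 1, so the weights `2⁻¹ ^ k` make `F` integrable.
  set F : X → ENNReal := fun x =>
    ∑' k, 2⁻¹ ^ k * ((3 ^ d k : ℕ) * (E k).indicator (fun _ => (1 : ENNReal)) x) with hF
  have hterm : ∀ k, Measurable fun x =>
      2⁻¹ ^ k * ((3 ^ d k : ℕ) * (E k).indicator (fun _ => (1 : ENNReal)) x) := fun k =>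
    ((measurable_const.indicator (hE k)).const_mul _).const_mul _
  have hFm : Measurable F := Measurable.tsum hterm
  have hFint : ∫⁻ x, F x ∂μ ≠ ⊤ := by
    have : ∫⁻ x, F x ∂μ ≤ ∑' k, 2⁻¹ ^ k := by
      rw [lintegral_tsum fun k => (hterm k).aemeasurable]
      refine ENNReal.tsum_le_tsum fun k => ?_
      rw [lintegral_const_mul _ ((measurable_const.indicator (hE k)).const_mul _),
        lintegral_const_mul _ (measurable_const.indicator (hE k)), lintegral_indicator_const (hE k),
        one_mul]
      exact mul_le_of_le_one_right' (hEμ k)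
    refine (this.trans_lt ?_).ne
    rw [ENNReal.tsum_geometric, ENNReal.one_sub_inv_two, inv_inv]
    exact ENNReal.ofNat_lt_top
  set f : X → ℝ := fun x => (F x).toReal ^ (1 / p) with hf
  have hf0 : ∀ x, 0 ≤ f x := fun x => by positivity
  have hfm : Measurable f := hFm.ennreal_toReal.pow_const _
  refine ⟨f, ?_, ?_⟩
  · rw [← integrable_norm_rpow_iff hfm.aestronglyMeasurable (by simpa using hp0)
      ENNReal.ofReal_ne_top, ENNReal.toReal_ofReal hp0.le]
    refine (integrable_toReal_of_lintegral_ne_top hFm.aemeasurable hFint).congr ?_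
    refine Eventually.of_forall fun x => ?_
    simp only [hf]
    rw [Real.norm_of_nonneg (by positivity), ← Real.rpow_mul ENNReal.toReal_nonneg,
      one_div_mul_cancel hp0.ne', Real.rpow_one]
  have hBsum : ∑' k, μ (B k) ≠ ⊤ := by
    have : ∑' k, μ (B k) ≤ ∑' k, 2 * 2⁻¹ ^ k := ENNReal.tsum_le_tsum fun k =>
      (hBμ k).trans (mul_two_div_four_pow_le ((hkd k).trans (hdL k)))
    refine (this.trans_lt ?_).ne
    rw [ENNReal.tsum_mul_left, ENNReal.tsum_geometric, ENNReal.one_sub_inv_two, inv_inv]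
    exact ENNReal.mul_lt_top ENNReal.ofNat_lt_top ENNReal.ofNat_lt_top
  have hFfin : ∀ᵐ x ∂μ, ∀ n, F (T^[n] x) < ⊤ :=
    ae_all_iff.2 fun n => (hT.iterate n).quasiMeasurePreserving.ae (ae_lt_top hFm hFint)
  -- Borel–Cantelli: almost every point eventually avoids the exceptional sets, so every large `k`
  -- supplies a good block.
  filter_upwards [ae_eventually_notMem hBsum, hFfin] with x hxB hxF
  refine limsup_coe_eq_top_of_frequently fun C => frequently_atTop.2 fun N₀ => ?_
  have hgrow : Tendsto (fun k : ℕ => (2 : ℝ) ^ k / 18) atTop atTop :=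
    (tendsto_pow_atTop_atTop_of_one_lt one_lt_two).atTop_div_const (by norm_num)
  obtain ⟨k, ⟨hk1, hk2⟩, hk3⟩ := ((hxB.and (eventually_ge_atTop N₀)).and
    (hgrow.eventually_ge_atTop C)).exists
  obtain ⟨j, hj, hjE⟩ := hB k x hk1
  set L := 3 ^ d k with hL
  have hLN : L ≤ 6 * (L * 2 ^ j) := by
    have : L ≤ L * 2 ^ j := Nat.le_mul_of_pos_right _ (by positivity)
    omega
  have hdN : d k ≤ 6 * (L * 2 ^ j) := (hdL k).trans hLN
  refine ⟨6 * (L * 2 ^ j), hk2.trans ((hkd k).trans hdN), hk3.trans ?_⟩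
  obtain ⟨hMpos, hMle⟩ := hd k _ hdN
  refine two_pow_div_le_of_block_bound hp hj hMpos hMle ?_
  refine card_mul_le_ergodicSum_two_pow hf0 (by positivity) fun m hm hm' => ?_
  have hmE : T^[4 ^ m] x ∈ E k := hjE m (by rwa [mul_assoc]) (by rwa [mul_assoc])
  have hle : 2⁻¹ ^ k * (L : ENNReal) ≤ F (T^[4 ^ m] x) := by
    refine le_trans (le_of_eq ?_) (ENNReal.le_tsum k)
    rw [Set.indicator_of_mem hmE, mul_one]
  have hle' := ENNReal.toReal_mono (hxF (4 ^ m)).ne hle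
  rw [ENNReal.toReal_mul, ENNReal.toReal_pow, ENNReal.toReal_inv, ENNReal.toReal_ofNat,
    ENNReal.toReal_natCast, inv_pow] at hle'
  exact Real.rpow_le_rpow (by positivity) hle' (by positivity)

end

theorem theoremB {X : Type*} [MeasurableSpace X] (μ : Measure X) (p : ℝ) (hp : 1 < p) :
    -- (1), for an arbitrary measure-preserving map and nonnegative times
    (∀ T : X → X, MeasurePreserving T μ μ →
      ∀ f : X → ℝ, MemLp f (ENNReal.ofReal p) μ → ∀ a : ℕ → ℕ,
        ∀ᵐ x ∂μ, Tendsto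
          (fun N : ℕ => 1 / ((N : ℝ) * (Real.log N) ^ (1 / p)) * ergodicSum T a f N x)
          atTop (𝓝 0)) ∧
    -- (1), for an invertible measure-preserving map and integer times
    (∀ T : X ≃ᵐ X, MeasurePreserving T μ μ →
      ∀ f : X → ℝ, MemLp f (ENNReal.ofReal p) μ → ∀ a : ℕ → ℤ,
        ∀ᵐ x ∂μ, Tendsto
          (fun N : ℕ => 1 / ((N : ℝ) * (Real.log N) ^ (1 / p)) * ergodicSumInt T.toEquiv a f N x)
          atTop (𝓝 0)) ∧
    -- (2)
    (∀ [MeasurableSpace.CountablySeparated X] [IsProbabilityMeasure μ],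
      ∀ T : X → X, MeasurePreserving T μ μ → IsAperiodic T μ →
      ∀ M : ℕ → ℝ, (∀ᶠ N in atTop, 0 < M N) →
        Tendsto (fun N : ℕ => M N / ((N : ℝ) * (Real.log N) ^ (1 / p))) atTop (𝓝 0) →
        (∃ (f : X → ℝ) (a : ℕ → ℕ), MemLp f (ENNReal.ofReal p) μ ∧
          ∀ᵐ x ∂μ, limsup
            (fun N : ℕ => ((1 / M N * ergodicSum T a f N x : ℝ) : EReal)) atTop = ⊤) ∧
        (∃ f : X → ℝ, MemLp f (ENNReal.ofReal p) μ ∧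
          ∀ᵐ x ∂μ, limsup
            (fun N : ℕ => ((1 / M N * ergodicSum T (fun n => 2 ^ n) f N x : ℝ) : EReal))
            atTop = ⊤)) := by
  refine ⟨fun T hT f hf a => ?_, fun T hT f hf a => ?_, ?_⟩
  · exact ae_tendsto_average_of_measurePreserving hp (fun n => hT.iterate (a n)) hf
  · exact ae_tendsto_average_of_measurePreserving hp (fun n => hT.equiv_zpow (a n)) hf
  · intro _ _ T hT hap M hM hM0
    have h := exists_memLp_limsup_ergodicSum_two_pow_eq_top hp hT hap hM hM0
    exact ⟨let ⟨f, hf⟩ := h; ⟨f, fun n => 2 ^ n, hf⟩, h⟩
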